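/- Let $K$ be an algebraically closed field of characteristic $0$ (for instance $K=\mathbb{C}$). *Definitions.* For a finite-dimensional Lie algebra $\mathfrak g$ over $K$ and $x\in\mathfrak g^*$ let $\mathcal A_x$ be the skew-symmetric bilinear form $\mathcal A_x(\xi,\eta)=\langle x,[\xi,\eta]\rangle$ on $\mathfrak g$. By the Jordan--Kronecker theorem, any pair $(A,B)$ of skew-symmetric forms on a finite-dimensional $K$-vector space is, in a suitable basis, block-diagonal with blocks $A_i=\begin{pmatrix}0&X\\-X^T&0\end{pmatrix}$, $B_i=\begin{pmatrix}0&Y\\-Y^T&0\end{pmatrix}$, where $(X,Y)$ is one of: $(J_n(\lambda),E_n)$ with $n\ge 1$, $\lambda\in K$ (Jordan $2n\times 2n$ block with eigenvalue $\lambda$; $J_n(\lambda)$ is the upper triangular Jordan cell); $(E_n,J_n(0))$ with $n\ge1$ (Jordan $2n\times 2n$ block with eigenvalue $\infty$); or the two $m\times(m+1)$ matrices $X=(E_m\,|\,0)$, $Y=(0\,|\,E_m)$ with $m\ge 0$ (Kronecker $(2m+1)\times(2m+1)$ block). The Jordan--Kronecker (JK) invariants of $\mathfrak g$ are the sizes of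 the Kronecker blocks, together with the sizes of the Jordan blocks grouped by eigenvalue (the values of the eigenvalues being forgotten), of the pair $(\mathcal A_x,\mathcal A_a)$ for all $(x,a)$ in some non-empty Zariski open subset of $\mathfrak g^*\times\mathfrak g^*$. **Theorem.** 1. For every $m\ge 0$ there is a Lie algebra over $K$ with basis $g_1,\dots,g_m,h_0,\dots,h_m$ and bracket $[g_i,h_0]=h_0$, $[g_i,h_i]=h_i$ ($i=1,\dots,m$), all other commutators of basis elements being $0$. The JK invariants of this Lie algebra consist of a single Kronecker $(2m+1)\times(2m+1)$ block (and no Jordan blocks). 2. For any $m_1,\dots,m_q\ge 0$, $q\ge 0$, the JK invariants of the direct sum of the Lie algebras from part 1 with $m=m_1,\dots,m_q$ consist of exactly the Kronecker blocks of sizes $2m_1+1,\dots,2m_q+1$ (and no Jordan blocks). Consequently, every finite collection (multiset) of odd positive integers is the collection of Kronecker sizes of a finite-dimensional Lie algebra over $K$ whose JK invariants contain no Jordan blocks. -/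

import Mathlib

universe u v

/-! ### Canonical blocks of a pair of skew-symmetric forms -/

/-- The types of blocks in the Jordan--Kronecker normal form of a pair of skew-symmetric forms:
a Jordan block of size `2n × 2n` (`n ≥ 1`) with eigenvalue `lam ∈ K`, a Jordan block of size
`2n × 2n` with eigenvalue `∞`, and a Kronecker block of size `(2m+1) × (2m+1)` (`m ≥ 0`), that is,
with Kronecker index `k = m + 1` and size `2k - 1`. -/
inductive JKBlock (K : Type u) : Type u
  | jordan (lam : K) (n : ℕ+) : JKBlock K
  | jordanInfty (n : ℕ+) : JKBlock K
  | kronecker (m : ℕ) : JKBlock K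

namespace JKBlock

/-- The index set of the standard basis of a block. -/
abbrev Index {K : Type u} : JKBlock K → Type
  | jordan _ n => Fin n ⊕ Fin n
  | jordanInfty n => Fin n ⊕ Fin n
  | kronecker m => Fin m ⊕ Fin (m + 1)

/-- The upper triangular `n × n` Jordan cell with eigenvalue `lam`. -/
def cell {K : Type u} [Field K] (n : ℕ) (lam : K) : Matrix (Fin n) (Fin n) K :=
  Matrix.of fun i j => if j = i then lam else if (j : ℕ) = i + 1 then 1 else 0

/-- The `m × (m+1)` matrix `(E | 0)`. -/
def kronP (K : Type u) [Field K] (m : ℕ) : Matrix (Fin m) (Fin (m + 1)) K :=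
  Matrix.of fun i j => if j = i.castSucc then 1 else 0

/-- The `m × (m+1)` matrix `(0 | E)`. -/
def kronQ (K : Type u) [Field K] (m : ℕ) : Matrix (Fin m) (Fin (m + 1)) K :=
  Matrix.of fun i j => if j = i.succ then 1 else 0

/-- The skew-symmetric matrix with off-diagonal blocks `X` and `-Xᵀ`. -/
def skew {K : Type u} [Field K] {p q : ℕ} (X : Matrix (Fin p) (Fin q) K) :
    Matrix (Fin p ⊕ Fin q) (Fin p ⊕ Fin q) K :=
  Matrix.fromBlocks 0 X (-X.transpose) 0

/-- The matrix of the first form `A` on a block. -/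
def matA {K : Type u} [Field K] : (β : JKBlock K) → Matrix β.Index β.Index K
  | jordan lam n => skew (cell n lam)
  | jordanInfty n => skew (1 : Matrix (Fin n) (Fin n) K)
  | kronecker m => skew (kronP K m)

/-- The matrix of the second form `B` on a block. -/
def matB {K : Type u} [Field K] : (β : JKBlock K) → Matrix β.Index β.Index K
  | jordan _ n => skew (1 : Matrix (Fin n) (Fin n) K)
  | jordanInfty n => skew (cell n (0 : K))
  | kronecker m => skew (kronQ K m)

/-- The size of a Kronecker block (`none` for Jordan blocks). -/
def kroneckerSize {K : Type u} : JKBlock K → Option ℕ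
  | jordan _ _ => none
  | jordanInfty _ => none
  | kronecker m => some (2 * m + 1)

/-- The eigenvalue in `K ∪ {∞}` and the size of a Jordan block (`none` for Kronecker blocks). -/
def jordanData {K : Type u} : JKBlock K → Option (OnePoint K × ℕ)
  | jordan lam n => some ((lam : OnePoint K), 2 * n)
  | jordanInfty n => some (OnePoint.infty, 2 * n)
  | kronecker _ => none

end JKBlock

/-! ### The algebraic type of a linear pencil -/

/-- A multiset of tuples (sizes of the Jordan blocks, one tuple for each eigenvalue) and numbers
(sizes of the Kronecker blocks). -/
@[ext]
structure AlgebraicType where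
  jordanTuples : Multiset (List ℕ)
  kroneckerSizes : Multiset ℕ

open Classical in
/-- The algebraic type of a multiset of blocks: sizes of Jordan blocks are grouped by eigenvalues
into tuples sorted in descending order, and the values of the eigenvalues are forgotten. -/
noncomputable def algebraicTypeOfBlocks {K : Type u} (s : Multiset (JKBlock K)) :
    AlgebraicType where
  jordanTuples :=
    ((s.filterMap JKBlock.jordanData).map Prod.fst).toFinset.val.map fun lam =>
      (((s.filterMap JKBlock.jordanData).filter fun d => d.1 = lam).map Prod.snd).sort (· ≥ ·)
  kroneckerSizes := s.filterMap JKBlock.kroneckerSize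

/-- `A` and `B` are simultaneously brought to the block-diagonal Jordan--Kronecker normal form with
blocks `β 0, …, β (N-1)` in some basis of `V`. -/
def HasJKForm {K : Type u} [Field K] {V : Type v} [AddCommGroup V] [Module K V]
    (A B : LinearMap.BilinForm K V) {N : ℕ} (β : Fin N → JKBlock K) : Prop :=
  ∃ b : Module.Basis (Σ i, (β i).Index) K V,
    (∀ (i : Fin N) (s t : (β i).Index),
      A (b ⟨i, s⟩) (b ⟨i, t⟩) = (β i).matA s t ∧ B (b ⟨i, s⟩) (b ⟨i, t⟩) = (β i).matB s t) ∧
    (∀ (i j : Fin N), i ≠ j → ∀ (s : (β i).Index) (t : (β j).Index),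
      A (b ⟨i, s⟩) (b ⟨j, t⟩) = 0 ∧ B (b ⟨i, s⟩) (b ⟨j, t⟩) = 0)

/-- The linear pencil `A + λ B` has algebraic type `τ`. -/
def HasAlgebraicType {K : Type u} [Field K] {V : Type v} [AddCommGroup V] [Module K V]
    (A B : LinearMap.BilinForm K V) (τ : AlgebraicType) : Prop :=
  ∃ (N : ℕ) (β : Fin N → JKBlock K), HasJKForm A B β ∧
    algebraicTypeOfBlocks (Finset.univ.val.map β) = τ

/-! ### Zariski open sets -/

/-- The algebra of polynomial functions on a vector space `W`, generated by the linear ones. -/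
def polyFunctionAlgebra (K : Type u) [Field K] (W : Type v) [AddCommGroup W] [Module K W] :
    Subalgebra K (W → K) :=
  Algebra.adjoin K (Set.range fun (f : Module.Dual K W) (w : W) => f w)

/-- `U` is Zariski open: its complement is the set of common zeros of a family of polynomials. -/
def IsZariskiOpen (K : Type u) [Field K] {W : Type v} [AddCommGroup W] [Module K W]
    (U : Set W) : Prop :=
  ∃ S : Set (W → K), S ⊆ polyFunctionAlgebra K W ∧ Uᶜ = {w | ∀ f ∈ S, f w = 0}

/-! ### Jordan--Kronecker invariants of a Lie algebra -/

/-- The form `𝒜_x (ξ, η) = ⟨x, [ξ, η]⟩` on a Lie algebra `L`, for `x` in the dual space. -/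
def lieForm {K : Type u} [Field K] {L : Type v} [LieRing L] [LieAlgebra K L]
    (x : Module.Dual K L) : LinearMap.BilinForm K L :=
  LinearMap.mk₂ K (fun ξ η => x ⁅ξ, η⁆) (by simp) (by simp) (by simp) (by simp)

/-- The Jordan--Kronecker invariants of the Lie algebra `L` are `τ`: the pencil
`𝒜_x + λ 𝒜_a` has algebraic type `τ` for all `(x, a)` in a non-empty Zariski open subset
of `L* × L*`. -/
def HasJKInvariants (K : Type u) [Field K] (L : Type v) [LieRing L] [LieAlgebra K L]
    (τ : AlgebraicType) : Prop :=
  ∃ U : Set (Module.Dual K L × Module.Dual K L), U.Nonempty ∧ IsZariskiOpen K U ∧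
    ∀ p ∈ U, HasAlgebraicType (lieForm p.1) (lieForm p.2) τ

/-- The basis `g_1, …, g_m, h_0, …, h_m` of `L` (with `g_(i+1) = b (inl i)` and `h_j = b (inr j)`)
satisfies `[g_i, h_0] = h_0`, `[g_i, h_i] = h_i`, and all other commutators of basis elements
vanish. -/
structure IsKroneckerBasis {K : Type u} [Field K] {L : Type v} [LieRing L] [LieAlgebra K L]
    {m : ℕ} (b : Module.Basis (Fin m ⊕ Fin (m + 1)) K L) : Prop where
  lie_g_h_zero : ∀ i, ⁅b (Sum.inl i), b (Sum.inr 0)⁆ = b (Sum.inr 0)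
  lie_g_h_self : ∀ i, ⁅b (Sum.inl i), b (Sum.inr i.succ)⁆ = b (Sum.inr i.succ)
  lie_g_h_other : ∀ i j, j ≠ 0 → j ≠ i.succ → ⁅b (Sum.inl i), b (Sum.inr j)⁆ = 0
  lie_g_g : ∀ i j, ⁅b (Sum.inl i), b (Sum.inl j)⁆ = 0
  lie_h_h : ∀ i j, ⁅b (Sum.inr i), b (Sum.inr j)⁆ = 0

/-!
In the basis `g_1, …, g_m, h_0, …, h_m` the form `𝒜_x` has off-diagonal block
`(𝟙 | E) * diag (x (h_0), …, x (h_m))`, where the column `𝟙` consists of ones. Suppose that the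
points `(x (h_k) : a (h_k))` of the projective line are pairwise distinct. The rows of the
homogeneous Vandermonde matrix of degree `m - 1` at these `m + 1` points satisfy a linear relation
`c`, and no coefficient of `c` vanishes because any `m` of the rows are independent. A change of the
`g_i` built from `c` turns `(𝟙 | E)` into the transposed Vandermonde matrix of degree `m - 1`, up to
a diagonal factor, and multiplication of forms of degree `m - 1` by each of the two homogeneous
coordinates then carries the pair `(E | 0)`, `(0 | E)` to the pair of blocks of `𝒜_x` and `𝒜_a`.

For a direct sum, intersect the preimages of the Zariski open sets of the summands: restricting
functionals to the summands splits the pencil, and pure Kronecker types just add up.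
-/

section ZariskiOpen

variable {K : Type u} [Field K] {W : Type v} [AddCommGroup W] [Module K W]

theorem isZariskiOpen_ne_zero {f : W → K} (hf : f ∈ polyFunctionAlgebra K W) :
    IsZariskiOpen K {w | f w ≠ 0} :=
  ⟨{f}, Set.singleton_subset_iff.mpr hf, by ext w; simp⟩

theorem IsZariskiOpen.iInter {ι : Type*} [Finite ι] {U : ι → Set W}
    (hU : ∀ i, IsZariskiOpen K (U i)) : IsZariskiOpen K (⋂ i, U i) := by
  cases nonempty_fintype ι
  choose S hS hSU using hU
  have mem_U_iff (i : ι) (w : W) : w ∈ U i ↔ ∃ f ∈ S i, f w ≠ 0 := by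
    rw [← Set.notMem_compl_iff, hSU]
    simp
  refine ⟨{g | ∃ f : ι → W → K, (∀ i, f i ∈ S i) ∧ g = ∏ i, f i}, ?_, ?_⟩
  · rintro _ ⟨f, hf, rfl⟩
    exact prod_mem fun i _ => hS i (hf i)
  · ext w
    rw [← not_iff_not, Set.notMem_compl_iff, Set.mem_iInter]
    simp only [mem_U_iff, Set.mem_ofPred_eq, not_forall]
    constructor
    · intro h
      choose f hf hfw using h
      exact ⟨∏ i, f i, ⟨f, hf, rfl⟩,
        by simpa only [Finset.prod_apply] using Finset.prod_ne_zero_iff.mpr fun i _ => hfw i⟩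
    · rintro ⟨_, ⟨f, hf, rfl⟩, hfw⟩ i
      rw [Finset.prod_apply] at hfw
      exact ⟨f i, hf i, Finset.prod_ne_zero_iff.mp hfw i (Finset.mem_univ i)⟩

theorem comp_mem_polyFunctionAlgebra {W' : Type*} [AddCommGroup W'] [Module K W']
    (φ : W →ₗ[K] W') {f : W' → K} (hf : f ∈ polyFunctionAlgebra K W') :
    f ∘ φ ∈ polyFunctionAlgebra K W := by
  induction hf using Algebra.adjoin_induction with
  | mem f hf =>
    obtain ⟨ℓ, rfl⟩ := hf
    exact Algebra.subset_adjoin ⟨ℓ ∘ₗ φ, rfl⟩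
  | algebraMap c => exact algebraMap_mem _ c
  | add f g _ _ hf hg => exact add_mem hf hg
  | mul f g _ _ hf hg => exact mul_mem hf hg

theorem IsZariskiOpen.preimage {W' : Type*} [AddCommGroup W'] [Module K W'] {U : Set W'}
    (hU : IsZariskiOpen K U) (φ : W →ₗ[K] W') : IsZariskiOpen K (φ ⁻¹' U) := by
  obtain ⟨S, hS, hSU⟩ := hU
  refine ⟨(· ∘ φ) '' S, ?_, ?_⟩
  · rintro _ ⟨f, hf, rfl⟩
    exact comp_mem_polyFunctionAlgebra φ (hS hf)
  · ext w
    simp [← Set.preimage_compl, hSU]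

end ZariskiOpen

section AlgebraicType

variable {K : Type u}

theorem algebraicTypeOfBlocks_eq_iff_of_no_jordan {s : Multiset (JKBlock K)} {t : Multiset ℕ} :
    algebraicTypeOfBlocks s = ⟨0, t⟩ ↔
      s.filterMap JKBlock.jordanData = 0 ∧ s.filterMap JKBlock.kroneckerSize = t := by
  simp only [AlgebraicType.ext_iff, algebraicTypeOfBlocks, Multiset.map_eq_zero,
    Finset.val_eq_zero, Multiset.toFinset_eq_empty]

theorem algebraicTypeOfBlocks_kronecker (m : ℕ) :
    algebraicTypeOfBlocks {(JKBlock.kronecker m : JKBlock K)} = ⟨0, {2 * m + 1}⟩ :=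
  algebraicTypeOfBlocks_eq_iff_of_no_jordan.mpr ⟨rfl, rfl⟩

theorem multiset_filterMap_sum {ι α β : Type*} (f : α → Option β) (s : Finset ι)
    (t : ι → Multiset α) :
    (∑ i ∈ s, t i).filterMap f = ∑ i ∈ s, (t i).filterMap f :=
  map_sum (⟨⟨Multiset.filterMap f, Multiset.filterMap_zero f⟩, Multiset.filterMap_add f⟩ :
    Multiset α →+ Multiset β) t s

theorem algebraicTypeOfBlocks_sum {ι : Type*} {I : Finset ι} {s : ι → Multiset (JKBlock K)}
    {t : ι → Multiset ℕ} (h : ∀ i ∈ I, algebraicTypeOfBlocks (s i) = ⟨0, t i⟩) :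
    algebraicTypeOfBlocks (∑ i ∈ I, s i) = ⟨0, ∑ i ∈ I, t i⟩ := by
  simp only [algebraicTypeOfBlocks_eq_iff_of_no_jordan] at h ⊢
  rw [multiset_filterMap_sum, multiset_filterMap_sum]
  exact ⟨Finset.sum_eq_zero fun i hi => (h i hi).1, Finset.sum_congr rfl fun i hi => (h i hi).2⟩

theorem val_map_eq_sum_singleton {ι α : Type*} (s : Finset ι) (f : ι → α) :
    s.val.map f = ∑ i ∈ s, {f i} := by
  rw [Finset.sum, ← Multiset.sum_map_singleton (s.val.map f), Multiset.map_map]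
  rfl

theorem univ_val_map_sigma {ι : Type*} {κ : ι → Type*} [Fintype ι] [∀ i, Fintype (κ i)]
    {α : Type*} (f : ∀ i, κ i → α) :
    ((Finset.univ : Finset (Σ i, κ i)).val.map fun p => f p.1 p.2) =
      ∑ i, Finset.univ.val.map (f i) := by
  simp only [val_map_eq_sum_singleton, Fintype.sum_sigma]

end AlgebraicType

section JKForm

variable {K : Type u} [Field K]

/-- `b` brings the pair `(A, B)` to the Jordan--Kronecker normal form with blocks `β`. Unlike in
`HasJKForm`, the blocks may be indexed by any type. -/
def IsJKBasis {V : Type v} [AddCommGroup V] [Module K V] (A B : LinearMap.BilinForm K V)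
    {κ : Type*} (β : κ → JKBlock K) (b : Module.Basis (Σ i, (β i).Index) K V) : Prop :=
  (∀ i (s t : (β i).Index),
    A (b ⟨i, s⟩) (b ⟨i, t⟩) = (β i).matA s t ∧ B (b ⟨i, s⟩) (b ⟨i, t⟩) = (β i).matB s t) ∧
  (∀ i j, i ≠ j → ∀ (s : (β i).Index) (t : (β j).Index),
    A (b ⟨i, s⟩) (b ⟨j, t⟩) = 0 ∧ B (b ⟨i, s⟩) (b ⟨j, t⟩) = 0)

theorem IsJKBasis.hasAlgebraicType {V : Type v} [AddCommGroup V] [Module K V]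
    {A B : LinearMap.BilinForm K V} {κ : Type*} [Fintype κ] {β : κ → JKBlock K}
    {b : Module.Basis (Σ i, (β i).Index) K V} (hb : IsJKBasis A B β b) :
    HasAlgebraicType A B (algebraicTypeOfBlocks (Finset.univ.val.map β)) := by
  let e : Fin (Fintype.card κ) ≃ κ := (Fintype.equivFin κ).symm
  let b' := b.reindex (Equiv.sigmaCongrLeft (β := fun i => (β i).Index) e).symm
  have b'_apply (i) (s : (β (e i)).Index) : b' ⟨i, s⟩ = b ⟨e i, s⟩ := by
    simp [b', Equiv.sigmaCongrLeft]
  refine ⟨_, β ∘ e, ⟨b', fun i s t => ?_, fun i j hij s t => ?_⟩, ?_⟩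
  · simpa only [b'_apply] using! hb.1 (e i) s t
  · simpa only [b'_apply] using! hb.2 (e i) (e j) (e.injective.ne hij) s t
  · rw [val_map_eq_sum_singleton, val_map_eq_sum_singleton]
    exact congrArg _ (e.sum_comp fun i => {β i})

theorem hasAlgebraicType_of_toMatrix_eq {V : Type v} [AddCommGroup V] [Module K V]
    {A B : LinearMap.BilinForm K V} {m : ℕ} (b : Module.Basis (Fin m ⊕ Fin (m + 1)) K V)
    (hA : LinearMap.BilinForm.toMatrix b A = JKBlock.skew (JKBlock.kronP K m))
    (hB : LinearMap.BilinForm.toMatrix b B = JKBlock.skew (JKBlock.kronQ K m)) :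
    HasAlgebraicType A B ⟨0, {2 * m + 1}⟩ := by
  rw [← algebraicTypeOfBlocks_kronecker (K := K)]
  let β : Unit → JKBlock K := fun _ => .kronecker m
  have hb : IsJKBasis A B β
      (b.reindex (Equiv.uniqueSigma fun i => (β i).Index).symm) := by
    refine ⟨fun _ s t => ⟨?_, ?_⟩, fun _ _ hij => absurd (Subsingleton.elim _ _) hij⟩
    · simpa using! congrFun₂ hA s t
    · simpa using! congrFun₂ hB s t
  exact hb.hasAlgebraicType

variable {ι : Type*} [DecidableEq ι] {V : ι → Type v} [∀ i, AddCommGroup (V i)]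
  [∀ i, Module K (V i)] {A B : LinearMap.BilinForm K (DirectSum ι V)}

theorem directSum_basis_apply {η : ι → Type*} (b : ∀ i, Module.Basis (η i) K (V i)) (i : ι)
    (s : η i) :
    (DFinsupp.basis b : Module.Basis (Σ i, η i) K (DirectSum ι V)) ⟨i, s⟩ =
      DirectSum.lof K ι V i (b i s) := by
  change _ = DFinsupp.single i (b i s)
  simp [DFinsupp.basis]

theorem IsJKBasis.directSum {κ : ι → Type*} {β : ∀ i, κ i → JKBlock K}
    {b : ∀ i, Module.Basis (Σ j, (β i j).Index) K (V i)}
    (hb : ∀ i, IsJKBasis (A.compl₁₂ (DirectSum.lof K ι V i) (DirectSum.lof K ι V i))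
      (B.compl₁₂ (DirectSum.lof K ι V i) (DirectSum.lof K ι V i)) (β i) (b i))
    (hA : ∀ i j, i ≠ j → A.compl₁₂ (DirectSum.lof K ι V i) (DirectSum.lof K ι V j) = 0)
    (hB : ∀ i j, i ≠ j → B.compl₁₂ (DirectSum.lof K ι V i) (DirectSum.lof K ι V j) = 0) :
    IsJKBasis A B (fun p : Σ i, κ i => β p.1 p.2) ((DFinsupp.basis b :
      Module.Basis _ K (DirectSum ι V)).reindex
        (Equiv.sigmaAssoc fun i j => (β i j).Index).symm) := by
  have basis_apply (i j) (s : (β i j).Index) : ((DFinsupp.basis b :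
      Module.Basis _ K (DirectSum ι V)).reindex
        (Equiv.sigmaAssoc fun i j => (β i j).Index).symm) ⟨⟨i, j⟩, s⟩ =
          DirectSum.lof K ι V i (b i ⟨j, s⟩) := by
    rw [Module.Basis.reindex_apply]
    exact directSum_basis_apply b i ⟨j, s⟩
  refine ⟨fun ⟨i, j⟩ s t => ?_, fun ⟨i, j⟩ ⟨i', j'⟩ hne s t => ?_⟩
  · rw [basis_apply, basis_apply]
    exact (hb i).1 j s t
  · rw [basis_apply, basis_apply]
    obtain rfl | hi := eq_or_ne i i'
    · exact (hb i).2 j j' (fun hj => hne (by rw [hj])) s t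
    · exact ⟨LinearMap.congr_fun₂ (hA i i' hi) _ _, LinearMap.congr_fun₂ (hB i i' hi) _ _⟩

theorem HasAlgebraicType.directSum [Fintype ι] {s : ι → Multiset ℕ}
    (h : ∀ i, HasAlgebraicType (A.compl₁₂ (DirectSum.lof K ι V i) (DirectSum.lof K ι V i))
      (B.compl₁₂ (DirectSum.lof K ι V i) (DirectSum.lof K ι V i)) ⟨0, s i⟩)
    (hA : ∀ i j, i ≠ j → A.compl₁₂ (DirectSum.lof K ι V i) (DirectSum.lof K ι V j) = 0)
    (hB : ∀ i j, i ≠ j → B.compl₁₂ (DirectSum.lof K ι V i) (DirectSum.lof K ι V j) = 0) :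
    HasAlgebraicType A B ⟨0, ∑ i, s i⟩ := by
  choose N β hβ hs using h
  choose b hb using hβ
  rw [← algebraicTypeOfBlocks_sum fun i _ => hs i, ← univ_val_map_sigma]
  exact (IsJKBasis.directSum hb hA hB).hasAlgebraicType

end JKForm

section LieForm

variable {K : Type u} [Field K]

theorem compl₁₂_lof_lieForm_self {ι : Type*} [DecidableEq ι] {L : ι → Type v}
    [∀ i, LieRing (L i)] [∀ i, LieAlgebra K (L i)] (x : Module.Dual K (DirectSum ι L)) (i : ι) :
    (lieForm x).compl₁₂ (DirectSum.lof K ι L i) (DirectSum.lof K ι L i) =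
      lieForm (x ∘ₗ DirectSum.lof K ι L i) := by
  ext v w
  exact congrArg x (DirectSum.lie_of_same L v w)

theorem compl₁₂_lof_lieForm_of_ne {ι : Type*} [DecidableEq ι] {L : ι → Type v}
    [∀ i, LieRing (L i)] [∀ i, LieAlgebra K (L i)] (x : Module.Dual K (DirectSum ι L)) {i j : ι}
    (hij : i ≠ j) :
    (lieForm x).compl₁₂ (DirectSum.lof K ι L i) (DirectSum.lof K ι L j) = 0 := by
  ext v w
  exact (congrArg x (DirectSum.lie_of_of_ne L hij v w)).trans (map_zero x)

theorem HasJKInvariants.directSum {ι : Type*} [Fintype ι] {L : ι → Type v}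
    [∀ i, LieRing (L i)] [∀ i, LieAlgebra K (L i)] {s : ι → Multiset ℕ}
    (h : ∀ i, HasJKInvariants K (L i) ⟨0, s i⟩) :
    HasJKInvariants K (DirectSum ι L) ⟨0, ∑ i, s i⟩ := by
  classical
  choose U hne hopen hU using h
  choose p hp using hne
  let restrict (i : ι) : Module.Dual K (DirectSum ι L) × Module.Dual K (DirectSum ι L) →ₗ[K]
      Module.Dual K (L i) × Module.Dual K (L i) :=
    (DirectSum.lof K ι L i).dualMap.prodMap (DirectSum.lof K ι L i).dualMap
  refine ⟨⋂ i, restrict i ⁻¹' U i, ?_, .iInter fun i => (hopen i).preimage _, fun q hq => ?_⟩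
  · refine ⟨(DirectSum.toModule K ι K fun i => (p i).1, DirectSum.toModule K ι K fun i => (p i).2),
      Set.mem_iInter.mpr fun i => ?_⟩
    have restrict_eq : restrict i (DirectSum.toModule K ι K fun i => (p i).1,
        DirectSum.toModule K ι K fun i => (p i).2) = p i := by
      ext <;> simp [restrict]
    simpa only [Set.mem_preimage, restrict_eq] using hp i
  · refine .directSum (fun i => ?_) (fun i j => compl₁₂_lof_lieForm_of_ne q.1)
      (fun i j => compl₁₂_lof_lieForm_of_ne q.2)
    rw [compl₁₂_lof_lieForm_self, compl₁₂_lof_lieForm_self]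
    exact hU i _ (Set.mem_iInter.mp hq i)

end LieForm

section NormalForm

variable {K : Type u} [Field K]

theorem exists_vecMul_eq_zero_of_forall_det_ne_zero {n : ℕ} {M : Matrix (Fin (n + 1)) (Fin n) K}
    (hM : ∀ k : Fin (n + 1), (M.submatrix k.succAbove id).det ≠ 0) :
    ∃ c : Fin (n + 1) → K, (∀ k, c k ≠ 0) ∧ Matrix.vecMul c M = 0 := by
  obtain ⟨c, hcM, hc⟩ := (Submodule.ne_bot_iff _).mp
    (M.vecMulLinear.ker_ne_bot_of_finrank_lt (by simp))
  rw [LinearMap.mem_ker, Matrix.vecMulLinear_apply] at hcM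
  refine ⟨c, fun k hck => hc ?_, hcM⟩
  have relation : Matrix.vecMul (c ∘ k.succAbove) (M.submatrix k.succAbove id) = 0 := by
    ext j
    simpa [Matrix.vecMul, dotProduct, Fin.sum_univ_succAbove _ k, hck] using congrFun hcM j
  have vanish := Matrix.eq_zero_of_vecMul_eq_zero (hM k) relation
  ext l
  obtain rfl | ⟨l, rfl⟩ := Fin.eq_self_or_eq_succAbove k l
  · exact hck
  · exact congrFun vanish l

theorem det_projVandermonde_ne_zero {n : ℕ} {v w : Fin n → K}
    (h : Pairwise fun i j => v i * w j ≠ v j * w i) : (Matrix.projVandermonde v w).det ≠ 0 := by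
  rw [Matrix.det_projVandermonde]
  exact Finset.prod_ne_zero_iff.mpr fun i _ => Finset.prod_ne_zero_iff.mpr fun j hj =>
    sub_ne_zero.mpr (h (Finset.mem_Ioi.mp hj).ne')

theorem kronP_mul {α : Type*} {m : ℕ} (N : Matrix (Fin (m + 1)) α K) :
    JKBlock.kronP K m * N = N.submatrix Fin.castSucc id := by
  ext i l
  simp [Matrix.mul_apply, JKBlock.kronP]

theorem kronQ_mul {α : Type*} {m : ℕ} (N : Matrix (Fin (m + 1)) α K) :
    JKBlock.kronQ K m * N = N.submatrix Fin.succ id := by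
  ext i l
  simp [Matrix.mul_apply, JKBlock.kronQ]

theorem kronP_mul_transpose_rectVandermonde {α : Type*} [Fintype α] [DecidableEq α]
    (v w : α → K) (m : ℕ) :
    JKBlock.kronP K m * (Matrix.rectVandermonde v w (m + 1)).transpose =
      (Matrix.rectVandermonde v w m).transpose * Matrix.diagonal w := by
  rw [kronP_mul]
  ext i l
  simp only [Matrix.submatrix_apply, id_eq, Matrix.mul_diagonal, Matrix.transpose_apply,
    Matrix.rectVandermonde_apply, Fin.rev_castSucc, Fin.val_castSucc, Fin.val_succ]
  ring

theorem kronQ_mul_transpose_rectVandermonde {α : Type*} [Fintype α] [DecidableEq α]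
    (v w : α → K) (m : ℕ) :
    JKBlock.kronQ K m * (Matrix.rectVandermonde v w (m + 1)).transpose =
      (Matrix.rectVandermonde v w m).transpose * Matrix.diagonal v := by
  rw [kronQ_mul]
  ext i l
  simp only [Matrix.submatrix_apply, id_eq, Matrix.mul_diagonal, Matrix.transpose_apply,
    Matrix.rectVandermonde_apply, Fin.rev_succ, Fin.val_castSucc, Fin.val_succ]
  ring

/-- The matrix `(𝟙 | E)` of the weights of `g_1, …, g_m` on `h_0, …, h_m`: its `(i, j)` entry is
the eigenvalue of `ad g_i` on `h_j`. -/
def kroneckerWeights (K : Type u) [Field K] (m : ℕ) : Matrix (Fin m) (Fin (m + 1)) K :=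
  Matrix.of fun i => Fin.cons 1 (Pi.single i 1)

theorem diagonal_mul_transpose_mul_kroneckerWeights {m n : ℕ} {c : Fin (m + 1) → K}
    {M : Matrix (Fin (m + 1)) (Fin n) K} (hc : Matrix.vecMul c M = 0) :
    (Matrix.diagonal (Fin.tail c) * M.submatrix Fin.succ id).transpose * kroneckerWeights K m =
      M.transpose * Matrix.diagonal (Fin.cons (-c 0) (Fin.tail c)) := by
  ext i l
  refine Fin.cases ?_ (fun l => ?_) l
  · have relation := congrFun hc i
    simp only [Matrix.vecMul, dotProduct, Fin.sum_univ_succ, Pi.zero_apply] at relation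
    have column_sum : ∑ k, c (Fin.succ k) * M k.succ i = -(c 0 * M 0 i) :=
      eq_neg_of_add_eq_zero_right relation
    simpa [Matrix.mul_apply, kroneckerWeights, Matrix.diagonal_apply, Fin.tail, mul_comm]
      using column_sum
  · simp [Matrix.mul_apply, kroneckerWeights, Matrix.diagonal_apply, Fin.tail, Pi.single_apply,
      mul_comm]

theorem exists_kroneckerWeights_normalForm {m : ℕ} {x a : Fin (m + 1) → K}
    (h : Pairwise fun j k => a j * x k ≠ a k * x j) :
    ∃ (P : Matrix (Fin m) (Fin m) K) (Q : Matrix (Fin (m + 1)) (Fin (m + 1)) K),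
      IsUnit P.det ∧ IsUnit Q.det ∧
      P.transpose * (kroneckerWeights K m * Matrix.diagonal x) * Q = JKBlock.kronP K m ∧
      P.transpose * (kroneckerWeights K m * Matrix.diagonal a) * Q = JKBlock.kronQ K m := by
  let M := Matrix.rectVandermonde a x m
  have hM (k : Fin (m + 1)) : (M.submatrix k.succAbove id).det ≠ 0 :=
    det_projVandermonde_ne_zero (h.comp_of_injective Fin.succAbove_right_injective)
  obtain ⟨c, hc, hcM⟩ := exists_vecMul_eq_zero_of_forall_det_ne_zero hM
  let D := Matrix.diagonal (Fin.cons (-c 0) (Fin.tail c) : Fin (m + 1) → K)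
  let P := Matrix.diagonal (Fin.tail c) * M.submatrix Fin.succ id
  let F := (Matrix.projVandermonde a x).transpose * D
  have hP : IsUnit P.det := by
    rw [isUnit_iff_ne_zero, Matrix.det_mul, Matrix.det_diagonal]
    exact mul_ne_zero (Finset.prod_ne_zero_iff.mpr fun k _ => hc k.succ) (hM 0)
  have hF : IsUnit F.det := by
    rw [isUnit_iff_ne_zero, Matrix.det_mul, Matrix.det_transpose, Matrix.det_diagonal,
      Fin.prod_univ_succ]
    exact mul_ne_zero (det_projVandermonde_ne_zero h) (mul_ne_zero (neg_ne_zero.mpr (hc 0))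
      (Finset.prod_ne_zero_iff.mpr fun k _ => hc k.succ))
  have normalForm_of_mul_eq (y : Fin (m + 1) → K) (R : Matrix (Fin m) (Fin (m + 1)) K)
      (hR : R * (Matrix.projVandermonde a x).transpose = M.transpose * Matrix.diagonal y) :
      P.transpose * (kroneckerWeights K m * Matrix.diagonal y) * F⁻¹ = R := by
    have mul_eq : P.transpose * (kroneckerWeights K m * Matrix.diagonal y) = R * F := by
      rw [← Matrix.mul_assoc, diagonal_mul_transpose_mul_kroneckerWeights hcM, Matrix.mul_assoc,
        ← Matrix.mul_assoc R, hR, Matrix.mul_assoc, (Matrix.commute_diagonal y _).eq]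
    rw [mul_eq, Matrix.mul_nonsing_inv_cancel_right F R hF]
  exact ⟨P, F⁻¹, hP, F.isUnit_nonsing_inv_det hF,
    normalForm_of_mul_eq x _ (kronP_mul_transpose_rectVandermonde a x m),
    normalForm_of_mul_eq a _ (kronQ_mul_transpose_rectVandermonde a x m)⟩

theorem transpose_fromBlocks_mul_skew_mul {p q : ℕ} (P : Matrix (Fin p) (Fin p) K)
    (Q : Matrix (Fin q) (Fin q) K) (X : Matrix (Fin p) (Fin q) K) :
    (Matrix.fromBlocks P 0 0 Q).transpose * JKBlock.skew X * Matrix.fromBlocks P 0 0 Q =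
      JKBlock.skew (P.transpose * X * Q) := by
  simp [JKBlock.skew, Matrix.fromBlocks_transpose, Matrix.fromBlocks_multiply, Matrix.mul_assoc]

theorem exists_basis_toMatrix_eq {R V n : Type*} [CommRing R] [AddCommGroup V] [Module R V]
    [Fintype n] [DecidableEq n] (b : Module.Basis n R V) {T : Matrix n n R} (hT : IsUnit T.det) :
    ∃ b' : Module.Basis n R V, ∀ A : LinearMap.BilinForm R V,
      LinearMap.BilinForm.toMatrix b' A =
        T.transpose * LinearMap.BilinForm.toMatrix b A * T := by
  refine ⟨b.map (Matrix.toLinearEquiv b T hT), fun A => ?_⟩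
  have toMatrix_eq : b.toMatrix (b.map (Matrix.toLinearEquiv b T hT)) = T := by
    ext i j
    simpa [Module.Basis.toMatrix_apply, LinearMap.toMatrix_apply] using!
      congrFun₂ (LinearMap.toMatrix_toLin b b T) i j
  rw [← LinearMap.BilinForm.toMatrix_mul_basis_toMatrix b, toMatrix_eq]

end NormalForm

section KroneckerBasis

variable {K : Type u} [Field K] {L : Type v} [LieRing L] [LieAlgebra K L] {m : ℕ}
  {b : Module.Basis (Fin m ⊕ Fin (m + 1)) K L}

theorem isKroneckerBasis_iff :
    IsKroneckerBasis b ↔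
      (∀ i j, ⁅b (Sum.inl i), b (Sum.inr j)⁆ = kroneckerWeights K m i j • b (Sum.inr j)) ∧
      (∀ i j, ⁅b (Sum.inl i), b (Sum.inl j)⁆ = 0) ∧
      (∀ i j, ⁅b (Sum.inr i), b (Sum.inr j)⁆ = 0) := by
  constructor
  · refine fun hb => ⟨fun i j => ?_, hb.lie_g_g, hb.lie_h_h⟩
    refine Fin.cases ?_ (fun j => ?_) j
    · simp [kroneckerWeights, hb.lie_g_h_zero]
    · obtain rfl | hij := eq_or_ne j i
      · simp [kroneckerWeights, hb.lie_g_h_self]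
      · simp [kroneckerWeights, hij,
          hb.lie_g_h_other i j.succ (Fin.succ_ne_zero j) ((Fin.succ_injective m).ne hij)]
  · rintro ⟨hgh, hgg, hhh⟩
    refine ⟨fun i => ?_, fun i => ?_, fun i j hj hji => ?_, hgg, hhh⟩
    · simp [hgh, kroneckerWeights]
    · simp [hgh, kroneckerWeights]
    · obtain ⟨j, rfl⟩ := Fin.exists_succ_eq.mpr hj
      have hji : j ≠ i := fun h => hji (congrArg Fin.succ h)
      simp [hgh, kroneckerWeights, hji]

theorem IsKroneckerBasis.toMatrix_lieForm (hb : IsKroneckerBasis b) (x : Module.Dual K L) :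
    LinearMap.BilinForm.toMatrix b (lieForm x) =
      JKBlock.skew (kroneckerWeights K m * Matrix.diagonal fun k => x (b (Sum.inr k))) := by
  obtain ⟨hgh, hgg, hhh⟩ := isKroneckerBasis_iff.mp hb
  have lieForm_apply (ξ η : L) : lieForm x ξ η = x ⁅ξ, η⁆ := rfl
  ext (i | i) (j | j) <;>
    simp only [LinearMap.BilinForm.toMatrix_apply, lieForm_apply, JKBlock.skew,
      Matrix.fromBlocks_apply₁₁, Matrix.fromBlocks_apply₁₂, Matrix.fromBlocks_apply₂₁,
      Matrix.fromBlocks_apply₂₂, Matrix.zero_apply, Matrix.neg_apply, Matrix.transpose_apply,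
      Matrix.mul_diagonal]
  · rw [hgg, map_zero]
  · rw [hgh, map_smul, smul_eq_mul]
  · rw [← lie_skew, map_neg, hgh, map_smul, smul_eq_mul]
  · rw [hhh, map_zero]

theorem IsKroneckerBasis.hasAlgebraicType_lieForm (hb : IsKroneckerBasis b)
    {x a : Module.Dual K L}
    (h : Pairwise fun j k =>
      a (b (Sum.inr j)) * x (b (Sum.inr k)) ≠ a (b (Sum.inr k)) * x (b (Sum.inr j))) :
    HasAlgebraicType (lieForm x) (lieForm a) ⟨0, {2 * m + 1}⟩ := by
  obtain ⟨P, Q, hP, hQ, hx, ha⟩ := exists_kroneckerWeights_normalForm h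
  have hPQ : IsUnit (Matrix.fromBlocks P 0 0 Q).det := by
    rw [Matrix.det_fromBlocks_zero₂₁]
    exact hP.mul hQ
  obtain ⟨b', hb'⟩ := exists_basis_toMatrix_eq b hPQ
  apply hasAlgebraicType_of_toMatrix_eq b'
  · rw [hb', hb.toMatrix_lieForm, transpose_fromBlocks_mul_skew_mul, hx]
  · rw [hb', hb.toMatrix_lieForm, transpose_fromBlocks_mul_skew_mul, ha]

theorem isZariskiOpen_pairwise_mul_ne_mul {V : Type*} [AddCommGroup V] [Module K V]
    {ι : Type*} [Finite ι] (v : ι → V) :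
    IsZariskiOpen K {p : Module.Dual K V × Module.Dual K V |
      Pairwise fun j k => p.2 (v j) * p.1 (v k) ≠ p.2 (v k) * p.1 (v j)} := by
  have fst_mem (w : V) : (fun p : Module.Dual K V × Module.Dual K V => p.1 w) ∈
      polyFunctionAlgebra K _ :=
    Algebra.subset_adjoin ⟨Module.Dual.eval K V w ∘ₗ LinearMap.fst K _ _, rfl⟩
  have snd_mem (w : V) : (fun p : Module.Dual K V × Module.Dual K V => p.2 w) ∈
      polyFunctionAlgebra K _ :=
    Algebra.subset_adjoin ⟨Module.Dual.eval K V w ∘ₗ LinearMap.snd K _ _, rfl⟩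
  have open_ne (e : {e : ι × ι // e.1 ≠ e.2}) :=
    isZariskiOpen_ne_zero (sub_mem (mul_mem (snd_mem (v e.1.1)) (fst_mem (v e.1.2)))
      (mul_mem (snd_mem (v e.1.2)) (fst_mem (v e.1.1))))
  convert! IsZariskiOpen.iInter open_ne
  ext p
  simp [Pairwise, sub_ne_zero]

theorem exists_pairwise_mul_ne_mul [Infinite K] {V : Type*} [AddCommGroup V] [Module K V]
    {ι κ : Type*} [Countable ι] (b : Module.Basis κ K V) {e : ι → κ} (he : e.Injective) :
    ∃ p : Module.Dual K V × Module.Dual K V,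
      Pairwise fun j k => p.2 (b (e j)) * p.1 (b (e k)) ≠ p.2 (b (e k)) * p.1 (b (e j)) := by
  obtain ⟨n, hn⟩ := Countable.exists_injective_nat ι
  let y (i : ι) : K := Infinite.natEmbedding K (n i)
  have hy : y.Injective := (Infinite.natEmbedding K).injective.comp hn
  refine ⟨(b.constr K fun _ => 1, b.constr K (Function.extend e y 0)), fun j k hjk => ?_⟩
  simpa [he.extend_apply] using hy.ne hjk

theorem IsKroneckerBasis.hasJKInvariants [Infinite K] (hb : IsKroneckerBasis b) :
    HasJKInvariants K L ⟨0, {2 * m + 1}⟩ :=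
  ⟨_, exists_pairwise_mul_ne_mul b Sum.inr_injective, isZariskiOpen_pairwise_mul_ne_mul _,
    fun _ => hb.hasAlgebraicType_lieForm⟩

end KroneckerBasis

section Existence

attribute [local instance] LieRing.ofAssociativeRing

/-- The action of the abelian Lie algebra `⟨g_1, …, g_m⟩` on the abelian Lie algebra
`⟨h_0, …, h_m⟩`, with both identified with spaces of coordinate vectors, whose bracket is the
commutator of the componentwise product and hence zero. -/
def kroneckerAction (K : Type u) [Field K] (m : ℕ) :
    (Fin m → K) →ₗ⁅K⁆ LieDerivation K (Fin (m + 1) → K) (Fin (m + 1) → K) where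
  toFun g :=
    { toLinearMap := LinearMap.mulLeft K (Matrix.vecMul g (kroneckerWeights K m))
      leibniz' := fun v w => by simp [LieRing.of_associative_ring_bracket, mul_comm] }
  map_add' g g' := by ext : 1; simp [Matrix.add_vecMul, add_mul]
  map_smul' c g := by ext : 1; simp [Matrix.smul_vecMul]
  map_lie' {g g'} := by
    ext : 1
    simp [LieRing.of_associative_ring_bracket, mul_comm, mul_left_comm]

theorem exists_isKroneckerBasis (K : Type u) [Field K] (m : ℕ) :
    ∃ (L : Type u) (_ : LieRing L) (_ : LieAlgebra K L)
      (b : Module.Basis (Fin m ⊕ Fin (m + 1)) K L), IsKroneckerBasis b := by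
  let ψ := kroneckerAction K m
  let b := (((Pi.basisFun K (Fin (m + 1))).prod (Pi.basisFun K (Fin m))).map
    (LieAlgebra.SemiDirectSum.toProdl ψ).symm).reindex (Equiv.sumComm _ _)
  have b_inl (i : Fin m) : b (Sum.inl i) = ⟨0, Pi.single i 1⟩ :=
    (LieAlgebra.SemiDirectSum.toProdl ψ).injective (by simp [b])
  have b_inr (j : Fin (m + 1)) : b (Sum.inr j) = ⟨Pi.single j 1, 0⟩ :=
    (LieAlgebra.SemiDirectSum.toProdl ψ).injective (by simp [b])
  have ψ_apply (g : Fin m → K) (h : Fin (m + 1) → K) :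
      ψ g h = Matrix.vecMul g (kroneckerWeights K m) * h := rfl
  refine ⟨_, inferInstance, inferInstance, b, isKroneckerBasis_iff.mpr ⟨?_, ?_, ?_⟩⟩
  · intro i j
    ext l
    · obtain rfl | hlj := eq_or_ne l j
      · simp [b_inl, b_inr, ψ_apply]
      · simp [b_inl, b_inr, ψ_apply, hlj]
    · simp [b_inl, b_inr]
  · intro i j
    simp [b_inl, LieRing.of_associative_ring_bracket, mul_comm]
  · intro i j
    simp [b_inr, LieRing.of_associative_ring_bracket, mul_comm]

end Existence

theorem exists_fin_two_mul_add_one_eq {s : Multiset ℕ} (hs : ∀ n ∈ s, Odd n) :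
    ∃ (q : ℕ) (m : Fin q → ℕ), Finset.univ.val.map (fun i => 2 * m i + 1) = s := by
  induction s using Quotient.inductionOn with | h l =>
  refine ⟨l.length, fun i => l[i] / 2, ?_⟩
  have two_mul_add_one (i : Fin l.length) : 2 * (l[i] / 2) + 1 = l[i] :=
    Nat.two_mul_div_two_add_one_of_odd (hs _ (List.getElem_mem _))
  simp only [two_mul_add_one]
  rw [Fin.univ_val_map]
  exact congrArg _ List.ofFn_getElem

theorem hasJKInvariants_directSum_of_isKroneckerBasis {K : Type u} [Field K] [Infinite K]
    {ι : Type*} [Fintype ι] {m : ι → ℕ} {L : ι → Type v} [∀ i, LieRing (L i)]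
    [∀ i, LieAlgebra K (L i)] {b : ∀ i, Module.Basis (Fin (m i) ⊕ Fin (m i + 1)) K (L i)}
    (hb : ∀ i, IsKroneckerBasis (b i)) :
    HasJKInvariants K (DirectSum ι L) ⟨0, Finset.univ.val.map fun i => 2 * m i + 1⟩ := by
  rw [val_map_eq_sum_singleton]
  exact .directSum fun i => (hb i).hasJKInvariants

theorem theoremT_general (K : Type u) [Field K] [Infinite K] :
    (∀ m : ℕ, ∃ (L : Type u) (_ : LieRing L) (_ : LieAlgebra K L)
      (b : Module.Basis (Fin m ⊕ Fin (m + 1)) K L), IsKroneckerBasis b) ∧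
    (∀ (m : ℕ) (L : Type v) [LieRing L] [LieAlgebra K L]
      (b : Module.Basis (Fin m ⊕ Fin (m + 1)) K L), IsKroneckerBasis b →
      HasJKInvariants K L { jordanTuples := 0, kroneckerSizes := {2 * m + 1} }) ∧
    (∀ (q : ℕ) (m : Fin q → ℕ) (L : Fin q → Type v) [∀ i, LieRing (L i)]
      [∀ i, LieAlgebra K (L i)]
      (b : ∀ i, Module.Basis (Fin (m i) ⊕ Fin (m i + 1)) K (L i)),
      (∀ i, IsKroneckerBasis (b i)) →
      HasJKInvariants K (DirectSum (Fin q) L)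
        { jordanTuples := 0, kroneckerSizes := Finset.univ.val.map fun i => 2 * m i + 1 }) ∧
    (∀ s : Multiset ℕ, (∀ n ∈ s, Odd n) →
      ∃ (L : Type u) (_ : LieRing L) (_ : LieAlgebra K L), FiniteDimensional K L ∧
        HasJKInvariants K L { jordanTuples := 0, kroneckerSizes := s }) := by
  refine ⟨exists_isKroneckerBasis K, fun m L _ _ b hb => hb.hasJKInvariants,
    fun q m L _ _ b hb => hasJKInvariants_directSum_of_isKroneckerBasis hb, fun s hs => ?_⟩
  obtain ⟨q, m, rfl⟩ := exists_fin_two_mul_add_one_eq hs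
  choose L _ _ b hb using fun i => exists_isKroneckerBasis K (m i)
  have finite (i : Fin q) : Module.Finite K (L i) := .of_basis (b i)
  exact ⟨DirectSum (Fin q) L, inferInstance, inferInstance, inferInstance,
    hasJKInvariants_directSum_of_isKroneckerBasis hb⟩

theorem theoremT (K : Type u) [Field K] [IsAlgClosed K] [CharZero K] :
    -- the Lie algebra with the given basis and brackets exists, for every `m ≥ 0`
    (∀ m : ℕ, ∃ (L : Type u) (_ : LieRing L) (_ : LieAlgebra K L)
      (b : Module.Basis (Fin m ⊕ Fin (m + 1)) K L), IsKroneckerBasis b) ∧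
    -- its invariants are a single Kronecker `(2m+1) × (2m+1)` block
    (∀ (m : ℕ) (L : Type v) [LieRing L] [LieAlgebra K L]
      (b : Module.Basis (Fin m ⊕ Fin (m + 1)) K L), IsKroneckerBasis b →
      HasJKInvariants K L { jordanTuples := 0, kroneckerSizes := {2 * m + 1} }) ∧
    -- the direct sum of such Lie algebras has the corresponding Kronecker blocks and no others
    (∀ (q : ℕ) (m : Fin q → ℕ) (L : Fin q → Type v) [∀ i, LieRing (L i)]
      [∀ i, LieAlgebra K (L i)]
      (b : ∀ i, Module.Basis (Fin (m i) ⊕ Fin (m i + 1)) K (L i)),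
      (∀ i, IsKroneckerBasis (b i)) →
      HasJKInvariants K (DirectSum (Fin q) L)
        { jordanTuples := 0, kroneckerSizes := Finset.univ.val.map fun i => 2 * m i + 1 }) ∧
    -- hence every finite collection of Kronecker sizes is realizable
    (∀ s : Multiset ℕ, (∀ n ∈ s, Odd n) →
      ∃ (L : Type u) (_ : LieRing L) (_ : LieAlgebra K L), FiniteDimensional K L ∧
        HasJKInvariants K L { jordanTuples := 0, kroneckerSizes := s }) :=
  theoremT_general K
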